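/- Let $m\ge 1$, let $\mathcal Z=\mathbb R^m$, let $\|\cdot\|$ be a norm on $\mathbb R^m$, let $\delta>0$ and $M\in[0,\infty)$. Setting. Let $X$ be a random variable with distribution $P_X$ in a measurable space $\mathcal X$, $Z$ a random variable with distribution $P_Z$ in $\mathbb R^m$, $G^\star:\mathbb R^m\to\mathcal X$ a measurable map, and $d:\mathcal X\times\mathcal X\to[0,\infty)$ a measurable function (a distortion measure). Put $$W_d(P,Q)=\inf_{\Pi}\mathbb E_{(X,Y)\sim\Pi}[d(X,Y)]\in[0,\infty],$$ the infimum over all joint distributions $\Pi$ on $\mathcal X\times\mathcal X$ with marginals $P$ and $Q$. For a rate $R\ge 0$ let $\mathcal W=\{1,\dots,\lfloor 2^R\rfloor\}$ (so $|\mathcal W|=2^R$ if $R$ is an integer). An encoder is a measurable map $E:\mathcal X\to\mathcal W$, a randomized encoder is a Markov kernel from $\mathcal X$ to $\mathcal W$, and $B$ denotes a stochastic map (Markov kernel) from $\mathcal W$ to $\mathbb R^m$, applied to the code with independent randomness. Let $D(R)$ be the minimal (infimal) value of $\mathbb E[d(X,G^\star(B(E(X))))]$ over all encoders $E$ and all $B$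 such that $B(E(X))\sim P_Z$, and let $D_{\mathrm{rand}}(R)$ be the same infimum when randomized encoders are also allowed. (1) There is a constant $C>0$, depending only on $\delta$, $m$, $M$ and $\|\cdot\|$, such that the following holds. If $\mathbb E[\|Z\|^{1+\delta}]=M$, $d$ is a metric on $\mathcal X$, and $G^\star$ is $K$-Lipschitz, i.e. $d(G^\star(x),G^\star(y))\le K\|x-y\|$ for all $x,y\in\mathbb R^m$, then for every $R\ge 0$ $$W_d(P_X,P_{G^\star(Z)})\ \le\ D_{\mathrm{rand}}(R)\ \le\ D(R)\ \le\ W_d(P_X,P_{G^\star(Z)})+2^{-R/m}\,K\,C .$$ (2) For an arbitrary measurable distortion measure $d$ (not necessarily a metric), an arbitrary measurable $G^\star$, arbitrary $P_Z$ (no moment assumption), every $R\ge0$, and all (possibly randomized) encoders $E$ and stochastic maps $B$ with $B(E(X))\sim P_Z$, $$W_d(P_X,P_{G^\star(B(E(X)))})=W_d(P_X,P_{G^\star(Z)}).$$ -/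

import Mathlib

open MeasureTheory ProbabilityTheory
open scoped ENNReal NNReal

universe u

namespace DPLC

/-- The codes available at rate `R` (in bits): a set with `⌊2 ^ R⌋` elements, which is `2 ^ R`
elements when `R` is a natural number. -/
abbrev Code (R : ℝ) : Type := Fin ⌊(2 : ℝ) ^ R⌋₊

noncomputable section

variable {𝒳 𝒵 : Type*} [MeasurableSpace 𝒳] [MeasurableSpace 𝒵]

/-- The Wasserstein distance of `μ` and `ν` for the transportation cost `c`: the infimum of the
expected cost over all joint distributions with marginals `μ` and `ν`. -/
def wasserstein (c : 𝒳 → 𝒳 → ℝ≥0) (μ ν : Measure 𝒳) : ℝ≥0∞ :=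
  ⨅ (π : Measure (𝒳 × 𝒳)) (_ : π.fst = μ ∧ π.snd = ν), ∫⁻ q, (c q.1 q.2 : ℝ≥0∞) ∂π

/-- The distribution of `B(E(X))` when `X` has distribution `μ`, for a (possibly randomized) encoder
`E` and a stochastic map `B` from codes to the latent space. -/
def latentLaw {R : ℝ} (μ : Measure 𝒳) (E : Kernel 𝒳 (Code R)) (B : Kernel (Code R) 𝒵) : Measure 𝒵 :=
  (μ.bind E).bind B

/-- The expected distortion `𝔼 d(X, G(B(E(X))))` when `X` has distribution `μ`. -/
def distortion {R : ℝ} (d : 𝒳 → 𝒳 → ℝ≥0) (μ : Measure 𝒳) (G : 𝒵 → 𝒳)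
    (E : Kernel 𝒳 (Code R)) (B : Kernel (Code R) 𝒵) : ℝ≥0∞ :=
  ∫⁻ x, ∫⁻ w, ∫⁻ z, (d x (G z) : ℝ≥0∞) ∂(B w) ∂(E x) ∂μ

/-- The minimal expected distortion at rate `R`, over deterministic encoders `E` and stochastic
maps `B` such that `B(E(X))` has the prior distribution `ν`. -/
def minDistortion (d : 𝒳 → 𝒳 → ℝ≥0) (μ : Measure 𝒳) (ν : Measure 𝒵) (G : 𝒵 → 𝒳) (R : ℝ) : ℝ≥0∞ :=
  ⨅ (E : 𝒳 → Code R) (hE : Measurable E) (B : Kernel (Code R) 𝒵) (_ : IsMarkovKernel B)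
    (_ : latentLaw μ (Kernel.deterministic E hE) B = ν),
    distortion d μ G (Kernel.deterministic E hE) B

/-- The same minimal expected distortion when the encoder may be randomized as well. -/
def minDistortionRandomized (d : 𝒳 → 𝒳 → ℝ≥0) (μ : Measure 𝒳) (ν : Measure 𝒵) (G : 𝒵 → 𝒳)
    (R : ℝ) : ℝ≥0∞ :=
  ⨅ (E : Kernel 𝒳 (Code R)) (_ : IsMarkovKernel E) (B : Kernel (Code R) 𝒵) (_ : IsMarkovKernel B)
    (_ : latentLaw μ E B = ν), distortion d μ G E B

end

end DPLC

/-!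
The lower bound holds because the joint law of the source `X` and its reconstruction is a coupling
of `P_X` with the law of `G` under the prior, for randomized encoders too. The claim about an
arbitrary distortion measure is immediate, since the latent law is the prior by assumption.

For the upper bound, quantize the latent space: let `q : 𝒵 → J` be a measurable map to a finite
set, with a representative `pt j` for each cell, and let `Q` be the mean distance between `G z`
and `G (pt (q z))`. A coupling of `P_X` with the law of `G` lifts to a coupling of `P_X` with the
prior (`exists_coupling_lift`), and so yields a transport plan from `P_X` to `J` that has the cell
probabilities as second marginal and costs at most `Q` more than the coupling.

Such a plan is randomized, while the encoder must be deterministic, and `P_X` may have atoms.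
Approximating the costs by simple functions reduces the plan to a finite table. A table with at
least `card J` split rows, that is, rows with two positive entries, has a direction that preserves
all row and column sums, by linear dependence; following it, with the sign for which the cost does
not increase, creates a new zero. Hence some plan with the same marginals and no larger cost
splits fewer than `card J` rows (`exists_plan_few_split_rows`). Each column gets a code word, used
by the unsplit rows, and each split row gets a code word of its own; the randomness of the split
rows moves into the stochastic map from code words to cells (`exists_deterministic_code`,
`exists_measurable_code`). With `2 * card J - 1` code words the encoder is thus deterministic.
Sampling from the prior conditioned on the selected cell makes the latent law equal to the prior,
and costs another `Q` (`minDistortion_le_of_code`). Therefore `D(R) ≤ W + 2 Q`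
(`minDistortion_le_add_quantization`).

It remains to find quantizers with error of order `2 ^ (-R / m)`. On the line, quantizing the
companding function `x ↦ 1 - (1 + |x|) ^ (-δ)` uniformly with `n` levels has error at most `(1 +
|x|) ^ (1 + δ) / (δ * n)` at every `x` (`exists_line_quantizer`), whose mean is controlled by the
moment of order `1 + δ`. Applying it in each coordinate, with `n` of order `2 ^ (R / m)`, gives
the claim (`exists_product_quantizer`, `exists_levels`).
-/

namespace DPLC


/-! ### Finite transport plans with few split rows -/

/-- Moving from a nonnegative vector `t` in a direction `v` that has a negative entry, and that
vanishes where `t` does, one reaches a nonnegative vector with a new zero. -/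
lemma exists_nonneg_add_smul_eq_zero {ι : Type*} [Fintype ι] (t v : ι → ℝ) (ht : ∀ p, 0 ≤ t p)
    (hv : ∀ p, v p ≠ 0 → 0 < t p) (hneg : ∃ p, v p < 0) :
    ∃ τ : ℝ, 0 ≤ τ ∧ (∀ p, 0 ≤ t p + τ * v p) ∧ ∃ p, 0 < t p ∧ t p + τ * v p = 0 := by
  classical
  obtain ⟨p₀, hp₀⟩ := hneg
  obtain ⟨p, hp, hmin⟩ := (Finset.univ.filter fun p => v p < 0).exists_min_image
    (fun p => t p / (-v p)) ⟨p₀, by simpa using hp₀⟩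
  have hp : v p < 0 := by simpa using hp
  refine ⟨t p / (-v p), div_nonneg (ht p) (by linarith), fun r => ?_, p, hv p hp.ne, ?_⟩
  · rcases lt_or_ge (v r) 0 with hr | hr
    · have h := hmin r (by simpa using hr)
      rw [le_div_iff₀ (by linarith)] at h
      linarith
    · have h := div_nonneg (ht p) (by linarith : 0 ≤ -v p)
      have := ht r
      positivity
  · have : v p ≠ 0 := hp.ne
    field_simp
    ring

/-- If `t` has at least `card J` rows with two positive entries, there is a direction along which
row sums and column sums are preserved and the cost does not increase. -/
lemma exists_cycle_direction {I J : Type*} [Fintype I] [Fintype J] [Nonempty J]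
    (c t : I → J → ℝ)
    (h : Fintype.card J ≤ Set.ncard {i | ∃ j j', j ≠ j' ∧ 0 < t i j ∧ 0 < t i j'}) :
    ∃ v : I → J → ℝ, (∀ i, ∑ j, v i j = 0) ∧ (∀ j, ∑ i, v i j = 0) ∧
      ∑ i, ∑ j, c i j * v i j ≤ 0 ∧ (∀ i j, v i j ≠ 0 → 0 < t i j) ∧ ∃ i j, v i j < 0 := by
  classical
  set S : Set I := {i | ∃ j j', j ≠ j' ∧ 0 < t i j ∧ 0 < t i j'} with hS
  choose! j₁ j₂ hne h₁ h₂ using fun i (hi : i ∈ S) => hi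
  obtain ⟨j₀⟩ := ‹Nonempty J›
  let u : I → J → ℝ := fun i => Pi.single (j₁ i) 1 - Pi.single (j₂ i) 1
  have hu : ∀ i, ∑ j, u i j = 0 := fun i => by simp [u, Finset.sum_sub_distrib]
  -- Each `u i` has zero sum, so one coordinate can be dropped: this gains one in the dimension.
  have hdep : ¬ LinearIndependent ℝ (fun (i : S) (j : {j // j ≠ j₀}) => u i j) := by
    intro hli
    have := hli.fintype_card_le_finrank
    rw [Module.finrank_fintype_fun_eq_card, Fintype.card_subtype_compl, Fintype.card_subtype_eq,
      ← Nat.card_eq_fintype_card, Nat.card_coe_set_eq] at this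
    have : 0 < Fintype.card J := Fintype.card_pos_iff.2 ⟨j₀⟩
    omega
  obtain ⟨g, hg, i₀, hi₀⟩ := Fintype.not_linearIndependent_iff.1 hdep
  have hcol' : ∀ j, j ≠ j₀ → ∑ i : S, g i * u i j = 0 := fun j hj => by
    simpa using congrFun hg ⟨j, hj⟩
  have hcol : ∀ j, ∑ i : S, g i * u i j = 0 := by
    intro j
    by_cases hj : j = j₀
    · subst hj
      have : ∑ k, ∑ i : S, g i * u i k = 0 := by
        rw [Finset.sum_comm]
        simp [← Finset.mul_sum, hu]
      rwa [Finset.sum_eq_single_of_mem j (Finset.mem_univ _) fun k _ hk => hcol' k hk] at this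
    · exact hcol' j hj
  let w : I → J → ℝ := fun i j => if hi : i ∈ S then g ⟨i, hi⟩ * u i j else 0
  have hwrow : ∀ i, ∑ j, w i j = 0 := by
    intro i
    by_cases hi : i ∈ S <;> simp [w, hi, ← Finset.mul_sum, hu]
  have hwcol : ∀ j, ∑ i, w i j = 0 := by
    intro j
    rw [← hcol j]
    refine (Fintype.sum_of_injective Subtype.val Subtype.val_injective _ _
      (fun i hi => ?_) fun i => ?_).symm
    · rw [Subtype.range_coe] at hi
      simp [w, hi]
    · simp [w]
  have hwpos : ∀ i j, w i j ≠ 0 → 0 < t i j := by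
    intro i j hw
    by_cases hi : i ∈ S
    · by_cases e₁ : j = j₁ i
      · exact e₁ ▸ h₁ i hi
      by_cases e₂ : j = j₂ i
      · exact e₂ ▸ h₂ i hi
      simp [w, hi, u, e₁, e₂] at hw
    · simp [w, hi] at hw
  have hw₁ : w i₀ (j₁ i₀) = g i₀ := by
    simp [w, u, Pi.single_eq_of_ne (hne i₀ i₀.2)]
  have hw₂ : w i₀ (j₂ i₀) = - g i₀ := by
    simp [w, u, Pi.single_eq_of_ne (hne i₀ i₀.2).symm]
  rcases le_total (∑ i, ∑ j, c i j * w i j) 0 with hc | hc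
  · refine ⟨w, hwrow, hwcol, hc, hwpos, ?_⟩
    rcases lt_or_gt_of_ne hi₀ with hlt | hlt
    · exact ⟨i₀, j₁ i₀, by linarith⟩
    · exact ⟨i₀, j₂ i₀, by linarith⟩
  · refine ⟨-w, by simpa using hwrow, by simpa using hwcol, by simpa using hc,
      fun i j hij => hwpos i j (by simpa using hij), ?_⟩
    rcases lt_or_gt_of_ne hi₀ with hlt | hlt
    · exact ⟨i₀, j₂ i₀, by simp only [Pi.neg_apply]; linarith⟩
    · exact ⟨i₀, j₁ i₀, by simp only [Pi.neg_apply]; linarith⟩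

/-- Every finite transport plan can be replaced by one that has the same marginals, costs no more,
and sends all but fewer than `card J` rows to a single column. -/
lemma exists_plan_few_split_rows {I J : Type*} [Fintype I] [Fintype J] [Nonempty J]
    (c t : I → J → ℝ) (ht : ∀ i j, 0 ≤ t i j) :
    ∃ s : I → J → ℝ, (∀ i j, 0 ≤ s i j) ∧ (∀ i, ∑ j, s i j = ∑ j, t i j) ∧
      (∀ j, ∑ i, s i j = ∑ i, t i j) ∧
      ∑ i, ∑ j, c i j * s i j ≤ ∑ i, ∑ j, c i j * t i j ∧
      Set.ncard {i | ∃ j j', j ≠ j' ∧ 0 < s i j ∧ 0 < s i j'} < Fintype.card J := by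
  classical
  -- Descent on the number of positive entries.
  induction hn : (Finset.univ.filter fun p : I × J => 0 < t p.1 p.2).card
    using Nat.strong_induction_on generalizing t with
  | _ n ih =>
    by_cases h : Set.ncard {i | ∃ j j', j ≠ j' ∧ 0 < t i j ∧ 0 < t i j'} < Fintype.card J
    · exact ⟨t, ht, fun _ => rfl, fun _ => rfl, le_rfl, h⟩
    obtain ⟨v, hrow, hcol, hcost, hpos, i, j, hij⟩ := exists_cycle_direction c t (not_lt.1 h)
    obtain ⟨τ, hτ, hnn, ⟨i', j'⟩, hp, hp0⟩ := exists_nonneg_add_smul_eq_zero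
      (fun p : I × J => t p.1 p.2) (fun p => v p.1 p.2) (fun p => ht _ _)
      (fun p => hpos _ _) ⟨(i, j), hij⟩
    have hlt : (Finset.univ.filter fun p : I × J => 0 < t p.1 p.2 + τ * v p.1 p.2).card < n := by
      rw [← hn]
      refine Finset.card_lt_card ((Finset.ssubset_iff_of_subset ?_).2 ⟨(i', j'), ?_, ?_⟩)
      · intro p hp
        simp only [Finset.mem_filter, Finset.mem_univ, true_and] at hp ⊢
        by_contra hle
        have h0 : v p.1 p.2 = 0 := by
          by_contra hv
          exact hle (hpos _ _ hv)
        rw [h0] at hp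
        exact hle (by simpa using hp)
      · simpa using hp
      · simpa using hp0.le
    obtain ⟨s, hs, hsr, hsc, hscost, hcard⟩ := ih _ hlt (fun i j => t i j + τ * v i j)
      (fun i j => hnn (i, j)) rfl
    refine ⟨s, hs, fun i => ?_, fun j => ?_, hscost.trans ?_, hcard⟩
    · rw [hsr, Finset.sum_add_distrib, ← Finset.mul_sum, hrow, mul_zero, add_zero]
    · rw [hsc, Finset.sum_add_distrib, ← Finset.mul_sum, hcol, mul_zero, add_zero]
    · have : ∑ i, ∑ j, c i j * (t i j + τ * v i j)
          = ∑ i, ∑ j, c i j * t i j + τ * ∑ i, ∑ j, c i j * v i j := by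
        simp only [mul_add, Finset.sum_add_distrib, Finset.mul_sum]
        congr 1
        refine Finset.sum_congr rfl fun i _ => Finset.sum_congr rfl fun j _ => by ring
      rw [this]
      nlinarith

/-- For every finite transport plan there is one with the same marginals and no larger cost that
consists of a deterministic code `e` for the rows followed by a random choice `a` of a column given
the code word. It needs `2 * card J - 1` code words: one for each column, and one for each of the
fewer than `card J` rows that are split. -/
lemma exists_deterministic_code {I J : Type*} [Fintype I] [Fintype J] [Nonempty J]
    (c t : I → J → ℝ≥0) {n : ℕ} (hn : 2 * Fintype.card J ≤ n + 1) :
    ∃ (e : I → Fin n) (a : Fin n → J → ℝ≥0), (∀ w, ∑ j, a w j = 1) ∧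
      (∀ j, ∑ i, (∑ k, t i k) * a (e i) j = ∑ i, t i j) ∧
      ∑ i, ∑ j, (∑ k, t i k) * a (e i) j * c i j ≤ ∑ i, ∑ j, t i j * c i j := by
  classical
  obtain ⟨s, hs, hsr, hsc, hcost, hcard⟩ := exists_plan_few_split_rows
    (fun i j => (c i j : ℝ)) (fun i j => (t i j : ℝ)) (fun i j => (t i j).2)
  lift s to I → J → ℝ≥0 using hs
  set S : Set I := {i | ∃ j j', j ≠ j' ∧ 0 < (s i j : ℝ) ∧ 0 < (s i j' : ℝ)} with hS
  have hsr : ∀ i, ∑ j, s i j = ∑ j, t i j := fun i => by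
    have := hsr i
    dsimp only at this
    exact_mod_cast this
  have hsc : ∀ j, ∑ i, s i j = ∑ i, t i j := fun j => by
    have := hsc j
    dsimp only at this
    exact_mod_cast this
  have hcost : ∑ i, ∑ j, c i j * s i j ≤ ∑ i, ∑ j, c i j * t i j := by
    dsimp only at hcost
    exact_mod_cast hcost
  obtain ⟨f⟩ : Nonempty (J ⊕ S ↪ Fin n) := by
    refine Function.Embedding.nonempty_of_card_le ?_
    rw [Fintype.card_sum, Fintype.card_fin, ← Nat.card_eq_fintype_card (α := S),
      Nat.card_coe_set_eq]
    omega
  obtain ⟨j₀⟩ := ‹Nonempty J›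
  let a₀ : J ⊕ S → J → ℝ≥0 :=
    Sum.elim (fun j => Pi.single j 1) fun i j => s i j / ∑ k, s i k
  let a : Fin n → J → ℝ≥0 := Function.extend f a₀ fun _ => Pi.single j₀ 1
  have ha : ∀ y, a (f y) = a₀ y := fun y => f.injective.extend_apply _ _ _
  have key : ∀ i, ∃ w, ∀ j, (∑ k, s i k) * a₀ w j = s i j := by
    intro i
    by_cases hi : i ∈ S
    · refine ⟨Sum.inr ⟨i, hi⟩, fun j => ?_⟩
      have : ∑ k, s i k ≠ 0 := by
        obtain ⟨j, -, -, hj, -⟩ := hi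
        exact (lt_of_lt_of_le (by exact_mod_cast hj)
          (Finset.single_le_sum (f := s i) (fun _ _ => zero_le) (Finset.mem_univ j))).ne'
      simp only [a₀, Sum.elim_inr]
      field_simp
    · by_cases h0 : ∀ j, s i j = 0
      · exact ⟨Sum.inl j₀, fun j => by simp [h0]⟩
      · push Not at h0
        obtain ⟨j, hj⟩ := h0
        have hz : ∀ k, k ≠ j → s i k = 0 := by
          intro k hk
          by_contra hk0
          exact hi ⟨k, j, hk, by exact_mod_cast pos_iff_ne_zero.2 hk0,
            by exact_mod_cast pos_iff_ne_zero.2 hj⟩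
        refine ⟨Sum.inl j, fun k => ?_⟩
        rw [Finset.sum_eq_single_of_mem j (Finset.mem_univ _) fun k _ hk => hz k hk]
        by_cases hk : k = j
        · subst hk; simp [a₀]
        · simp [a₀, hk, hz k hk]
  choose w hw using key
  have hw' : ∀ i j, (∑ k, t i k) * a (f (w i)) j = s i j := fun i j => by
    rw [← hsr, ← hw i j, ha]
  refine ⟨fun i => f (w i), a, fun x => ?_, fun j => ?_, ?_⟩
  · by_cases hx : ∃ y, f y = x
    · obtain ⟨y, rfl⟩ := hx
      rw [ha]
      rcases y with j | ⟨i, hi⟩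
      · simp [a₀]
      · have : ∑ k, s i k ≠ 0 := by
          obtain ⟨j, -, -, hj, -⟩ := hi
          exact (lt_of_lt_of_le (by exact_mod_cast hj)
            (Finset.single_le_sum (f := s i) (fun _ _ => zero_le) (Finset.mem_univ j))).ne'
        simp only [a₀, Sum.elim_inr, ← Finset.sum_div]
        exact div_self this
    · simp [a, Function.extend_apply' _ _ _ hx]
  · simp only [hw', hsc]
  · simp only [hw']
    simpa only [mul_comm] using hcost


/-! ### Deterministic encoders from transport plans to a finite set -/

/-- A function with finite integral is approximated from below by simple functions. -/
lemma exists_simpleFunc_le_lintegral_le_add {𝒳 : Type*} [MeasurableSpace 𝒳] (P : Measure 𝒳)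
    {f : 𝒳 → ℝ≥0∞} (hf : ∫⁻ x, f x ∂P ≠ ∞) {ε : ℝ≥0∞} (hε : ε ≠ 0) :
    ∃ φ : SimpleFunc 𝒳 ℝ≥0, (∀ x, (φ x : ℝ≥0∞) ≤ f x) ∧
      ∫⁻ x, f x ∂P ≤ ∫⁻ x, (φ x : ℝ≥0∞) ∂P + ε := by
  by_cases h0 : ∫⁻ x, f x ∂P = 0
  · exact ⟨0, by simp, by simp [h0]⟩
  have hlt := ENNReal.sub_lt_self hf h0 hε
  conv_rhs at hlt => rw [lintegral_eq_nnreal]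
  simp only [lt_iSup_iff] at hlt
  obtain ⟨φ, hφ, hlt⟩ := hlt
  refine ⟨φ, hφ, tsub_le_iff_right.1 (hlt.le.trans_eq ?_)⟩
  rw [← SimpleFunc.lintegral_eq_lintegral]
  rfl

/-- A transport plan `T` from `P` to a finite set `J` is, up to an arbitrarily small increase of the
cost, a deterministic map into `2 * card J - 1` code words followed by a stochastic map `a` from
code words to `J`. Replacing the costs by simple functions makes the plan finite; in particular a source
without atoms needs no separate treatment. -/
lemma exists_measurable_code {𝒳 J : Type*} [MeasurableSpace 𝒳] [Fintype J] [Nonempty J]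
    [MeasurableSpace J] [MeasurableSingletonClass J] (T : Measure (𝒳 × J)) [IsFiniteMeasure T]
    (c : 𝒳 → J → ℝ≥0) (hc : ∀ j, Measurable fun x => c x j)
    (hfin : ∀ j, ∫⁻ x, c x j ∂T.fst ≠ ∞) {n : ℕ} (hn : 2 * Fintype.card J ≤ n + 1)
    {ε : ℝ≥0∞} (hε : ε ≠ 0) :
    ∃ (e : 𝒳 → Fin n) (a : Fin n → J → ℝ≥0), Measurable e ∧ (∀ w, ∑ j, a w j = 1) ∧
      (∀ j, ∫⁻ x, a (e x) j ∂T.fst = T.snd {j}) ∧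
      ∫⁻ x, ∑ j, (a (e x) j * c x j : ℝ≥0∞) ∂T.fst ≤ ∫⁻ r, c r.1 r.2 ∂T + ε := by
  classical
  have hε' : ε / Fintype.card J ≠ 0 := ENNReal.div_ne_zero.2 ⟨hε, ENNReal.natCast_ne_top _⟩
  choose φ hφc hφ using fun j => exists_simpleFunc_le_lintegral_le_add T.fst (hfin j) hε'
  let I := (j : J) → (φ j).range
  let κ : 𝒳 → I := fun x j => ⟨φ j x, SimpleFunc.mem_range_self _ x⟩
  have hκ : Measurable κ :=
    measurable_pi_iff.2 fun j => (φ j).measurable.subtype_mk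
  let T' : Measure (I × J) := T.map fun r => (κ r.1, r.2)
  have hκ' : Measurable fun r : 𝒳 × J => (κ r.1, r.2) := by fun_prop
  let t : I → J → ℝ≥0 := fun i j => (T' {(i, j)}).toNNReal
  have ht : ∀ f : I → J → ℝ≥0∞, ∫⁻ r, f (κ r.1) r.2 ∂T = ∑ i, ∑ j, t i j * f i j := by
    intro f
    have h1 : ∫⁻ r, f (κ r.1) r.2 ∂T = ∫⁻ p, f p.1 p.2 ∂T' :=
      (lintegral_map (f := fun p : I × J => f p.1 p.2) (measurable_of_countable _) hκ').symm
    rw [h1, lintegral_fintype, Fintype.sum_prod_type]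
    refine Finset.sum_congr rfl fun i _ => Finset.sum_congr rfl fun j _ => ?_
    rw [ENNReal.coe_toNNReal (measure_ne_top _ _), mul_comm]
  have htfst : ∀ f : I → ℝ≥0∞, ∫⁻ x, f (κ x) ∂T.fst = ∑ i, (∑ j, t i j : ℝ≥0) * f i := by
    intro f
    have hm : Measurable fun x => f (κ x) := (measurable_of_countable f).comp hκ
    rw [Measure.fst, lintegral_map hm measurable_fst, ht fun i _ => f i]
    simp [Finset.sum_mul]
  obtain ⟨e, a, ha, hmarg, hcost⟩ := exists_deterministic_code (fun (i : I) j => (i j : ℝ≥0)) t hn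
  refine ⟨fun x => e (κ x), a, (measurable_of_countable e).comp hκ, ha, fun j => ?_, ?_⟩
  · rw [htfst fun i => a (e i) j]
    have h2 : T.snd {j} = ∫⁻ r, (if r.2 = j then 1 else 0) ∂T := by
      rw [Measure.snd_apply (measurableSet_singleton j),
        ← lintegral_indicator_one (measurable_snd (measurableSet_singleton j))]
      rfl
    rw [h2, ht fun _ k => if k = j then 1 else 0]
    simp only [mul_ite, mul_one, mul_zero, Finset.sum_ite_eq', Finset.mem_univ, if_true]
    exact_mod_cast hmarg j
  · have ha1 : ∀ w j, (a w j : ℝ≥0∞) ≤ 1 := fun w j => by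
      rw [← ENNReal.coe_one, ← ha w]
      exact_mod_cast Finset.single_le_sum (f := a w) (fun _ _ => zero_le) (Finset.mem_univ j)
    have hme : ∀ j, Measurable fun x => (a (e (κ x)) j : ℝ≥0∞) := fun j =>
      (measurable_of_countable fun i => (a (e i) j : ℝ≥0∞)).comp hκ
    have hmφ : ∀ j, Measurable fun x => (φ j x : ℝ≥0∞) := fun j =>
      (φ j).measurable.coe_nnreal_ennreal
    have hmc : ∀ j, Measurable fun x => (c x j : ℝ≥0∞) := fun j => (hc j).coe_nnreal_ennreal
    calc ∫⁻ x, ∑ j, (a (e (κ x)) j * c x j : ℝ≥0∞) ∂T.fst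
        ≤ ∫⁻ x, ((∑ j, (a (e (κ x)) j * φ j x : ℝ≥0∞)) + ∑ j, (c x j - φ j x : ℝ≥0∞)) ∂T.fst := by
          refine lintegral_mono fun x => ?_
          rw [← Finset.sum_add_distrib]
          refine Finset.sum_le_sum fun j _ => ?_
          calc (a (e (κ x)) j * c x j : ℝ≥0∞)
              = a (e (κ x)) j * φ j x + a (e (κ x)) j * (c x j - φ j x) := by
                rw [← mul_add, add_tsub_cancel_of_le (hφc j x)]
            _ ≤ a (e (κ x)) j * φ j x + (c x j - φ j x) := by
                gcongr
                exact mul_le_of_le_one_left' (ha1 _ _)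
      _ = ∫⁻ x, ∑ j, (a (e (κ x)) j * φ j x : ℝ≥0∞) ∂T.fst
          + ∑ j, ∫⁻ x, (c x j - φ j x : ℝ≥0∞) ∂T.fst := by
          have hm : Measurable fun x => ∑ j, (a (e (κ x)) j * φ j x : ℝ≥0∞) :=
            Finset.measurable_fun_sum _ fun j _ => (hme j).mul (hmφ j)
          have hmsub : ∀ j, Measurable fun x => (c x j - φ j x : ℝ≥0∞) := fun j =>
            (hmc j).sub (hmφ j)
          rw [lintegral_add_left hm, lintegral_finsetSum _ fun j _ => hmsub j]
      _ ≤ ∫⁻ r, c r.1 r.2 ∂T + ε := by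
          gcongr
          · calc ∫⁻ x, ∑ j, (a (e (κ x)) j * φ j x : ℝ≥0∞) ∂T.fst
                = ∑ i : I, (∑ j, t i j : ℝ≥0) * ∑ j, (a (e i) j * (i j : ℝ≥0) : ℝ≥0∞) :=
                  htfst fun i => ∑ j, (a (e i) j * (i j : ℝ≥0) : ℝ≥0∞)
              _ ≤ ∑ i : I, ∑ j, (t i j : ℝ≥0∞) * (i j : ℝ≥0) := by
                  simp only [Finset.mul_sum, ← mul_assoc]
                  exact_mod_cast hcost
              _ = ∫⁻ r, φ r.2 r.1 ∂T := (ht fun i j => ((i j : ℝ≥0) : ℝ≥0∞)).symm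
              _ ≤ ∫⁻ r, c r.1 r.2 ∂T := lintegral_mono fun r => hφc r.2 r.1
          · calc ∑ j, ∫⁻ x, (c x j - φ j x : ℝ≥0∞) ∂T.fst
                ≤ ∑ _j : J, ε / Fintype.card J := by
                  refine Finset.sum_le_sum fun j _ => ?_
                  have hφfin : ∫⁻ x, (φ j x : ℝ≥0∞) ∂T.fst ≠ ∞ :=
                    ne_top_of_le_ne_top (hfin j) (lintegral_mono (hφc j))
                  rw [lintegral_sub (hmφ j) hφfin (Filter.Eventually.of_forall (hφc j))]
                  exact tsub_le_iff_left.2 (hφ j)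
              _ = ε := by
                  rw [Finset.sum_const, Finset.card_univ, nsmul_eq_mul]
                  exact ENNReal.mul_div_cancel (by simp) (ENNReal.natCast_ne_top _)

/-! ### Decoding by resampling inside a cell -/

/-- The cells of a measurable map to a finite set partition the measure. -/
lemma sum_restrict_preimage_singleton {𝒵 J : Type*} [MeasurableSpace 𝒵] [Fintype J]
    [MeasurableSpace J] [MeasurableSingletonClass J] (ν : Measure 𝒵) {q : 𝒵 → J}
    (hq : Measurable q) : ∑ j, ν.restrict (q ⁻¹' {j}) = ν := by
  ext s hs
  have h := sum_measure_preimage_singleton (μ := ν.restrict s) (Finset.univ : Finset J) (f := q)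
    fun y _ => hq (measurableSet_singleton y)
  simp only [Finset.coe_univ, Set.preimage_univ, Measure.restrict_apply_univ] at h
  rw [← h, Measure.finsetSum_apply]
  refine Finset.sum_congr rfl fun j _ => ?_
  rw [Measure.restrict_apply hs, Measure.restrict_apply (hq (measurableSet_singleton j)),
    Set.inter_comm]

/-- Conditioning on a cell, extended to null cells by an arbitrary probability measure. -/
lemma exists_probability_smul_eq_restrict {𝒵 : Type*} [MeasurableSpace 𝒵] (ν : Measure 𝒵)
    [IsProbabilityMeasure ν] (s : Set 𝒵) :
    ∃ β : Measure 𝒵, IsProbabilityMeasure β ∧ ν s • β = ν.restrict s := by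
  by_cases hs : ν s = 0
  · exact ⟨ν, inferInstance, by rw [hs, zero_smul, Measure.restrict_eq_zero.2 hs]⟩
  · refine ⟨ν[|s], cond_isProbabilityMeasure hs, ?_⟩
    rw [ProbabilityTheory.cond, smul_smul, ENNReal.mul_inv_cancel hs (measure_ne_top _ _), one_smul]

lemma coe_nndist_triangle {𝒳 : Type*} [PseudoMetricSpace 𝒳] (x y z : 𝒳) :
    (nndist x z : ℝ≥0∞) ≤ nndist x y + nndist y z := by
  simpa only [edist_nndist] using edist_triangle x y z

/-- A deterministic encoder `e` with random choices `a` of cells yields a stochastic map with the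
prior as latent law: in the chosen cell, the latent variable is sampled from the prior conditioned
on the cell. This costs at most the mean distance to the cell's representative. -/
lemma minDistortion_le_of_code {𝒳 𝒵 J : Type*} [PseudoMetricSpace 𝒳] [MeasurableSpace 𝒳]
    [MeasurableSpace 𝒵] [Fintype J] [MeasurableSpace J] [MeasurableSingletonClass J]
    (hd : Measurable fun r : 𝒳 × 𝒳 => nndist r.1 r.2)
    (P : Measure 𝒳) (ν : Measure 𝒵) [IsProbabilityMeasure ν]
    {G : 𝒵 → 𝒳} (hG : Measurable G) {q : 𝒵 → J} (hq : Measurable q) (pt : J → 𝒵) {R : ℝ}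
    {e : 𝒳 → Code R} (he : Measurable e) {a : Code R → J → ℝ≥0} (ha : ∀ w, ∑ j, a w j = 1)
    (hmarg : ∀ j, ∫⁻ x, a (e x) j ∂P = ν (q ⁻¹' {j})) :
    minDistortion nndist P ν G R ≤
      ∫⁻ x, ∑ j, (a (e x) j * nndist x (G (pt j)) : ℝ≥0∞) ∂P
        + ∫⁻ z, nndist (G z) (G (pt (q z))) ∂ν := by
  choose β hβ hβν using fun j => exists_probability_smul_eq_restrict ν (q ⁻¹' {j})
  let B : Kernel (Code R) 𝒵 := Kernel.ofFunOfCountable fun w => ∑ j, (a w j : ℝ≥0∞) • β j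
  have hBint : ∀ w (f : 𝒵 → ℝ≥0∞), ∫⁻ z, f z ∂(B w) = ∑ j, a w j * ∫⁻ z, f z ∂(β j) := by
    intro w f
    change ∫⁻ z, f z ∂(∑ j, (a w j : ℝ≥0∞) • β j) = _
    rw [lintegral_finsetSum_measure]
    simp only [lintegral_smul_measure, smul_eq_mul]
  have hB : IsMarkovKernel B := ⟨fun w => ⟨by
    rw [← lintegral_one, hBint]
    simp only [lintegral_one, measure_univ, mul_one]
    exact_mod_cast ha w⟩⟩
  have hme : ∀ j, Measurable fun x => (a (e x) j : ℝ≥0∞) := fun j =>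
    (measurable_of_countable fun w => (a w j : ℝ≥0∞)).comp he
  have hlaw : latentLaw P (Kernel.deterministic e he) B = ν := by
    rw [latentLaw, Measure.deterministic_comp_eq_map]
    ext s hs
    rw [Measure.bind_apply hs B.aemeasurable, lintegral_map (B.measurable_coe hs) he]
    calc ∫⁻ x, B (e x) s ∂P = ∫⁻ x, ∑ j, (a (e x) j * β j s : ℝ≥0∞) ∂P := by
          refine lintegral_congr fun x => ?_
          rw [← lintegral_indicator_one hs, hBint]
          simp only [lintegral_indicator_one hs]
      _ = ∑ j, ν (q ⁻¹' {j}) * β j s := by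
          rw [lintegral_finsetSum _ fun j _ => (hme j).mul_const _]
          simp only [lintegral_mul_const _ (hme _), hmarg]
      _ = ν s := by
          conv_rhs => rw [← sum_restrict_preimage_singleton ν hq, Measure.finsetSum_apply]
          simp only [← hβν, Measure.smul_apply, smul_eq_mul]
  have hdG : ∀ x, Measurable fun z => (nndist x (G z) : ℝ≥0∞) := fun x =>
    (hd.comp (measurable_const.prodMk hG)).coe_nnreal_ennreal
  have hdx : ∀ y, Measurable fun x => (nndist x y : ℝ≥0∞) := fun y =>
    (hd.comp (measurable_id.prodMk measurable_const)).coe_nnreal_ennreal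
  refine LE.le.trans (b := distortion nndist P G (Kernel.deterministic e he) B)
    (iInf₂_le_of_le e he (iInf₂_le_of_le B hB (iInf_le _ hlaw))) ?_
  calc distortion nndist P G (Kernel.deterministic e he) B
      = ∫⁻ x, ∑ j, a (e x) j * ∫⁻ z, nndist x (G z) ∂(β j) ∂P := by
        refine lintegral_congr fun x => ?_
        rw [Kernel.lintegral_deterministic' _ (measurable_of_countable _), hBint]
    _ ≤ ∫⁻ x, ((∑ j, (a (e x) j * nndist x (G (pt j)) : ℝ≥0∞))
          + ∑ j, a (e x) j * ∫⁻ z, nndist (G (pt j)) (G z) ∂(β j)) ∂P := by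
        refine lintegral_mono fun x => ?_
        rw [← Finset.sum_add_distrib]
        refine Finset.sum_le_sum fun j _ => ?_
        rw [← mul_add]
        gcongr
        calc ∫⁻ z, nndist x (G z) ∂(β j)
            ≤ ∫⁻ z, (nndist x (G (pt j)) + nndist (G (pt j)) (G z) : ℝ≥0∞) ∂(β j) :=
              lintegral_mono fun z => coe_nndist_triangle _ _ _
          _ = nndist x (G (pt j)) + ∫⁻ z, nndist (G (pt j)) (G z) ∂(β j) := by
              rw [lintegral_add_left measurable_const, lintegral_const, measure_univ, mul_one]
    _ = ∫⁻ x, ∑ j, (a (e x) j * nndist x (G (pt j)) : ℝ≥0∞) ∂P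
          + ∑ j, ν (q ⁻¹' {j}) * ∫⁻ z, nndist (G (pt j)) (G z) ∂(β j) := by
        have hm : Measurable fun x => ∑ j, (a (e x) j * nndist x (G (pt j)) : ℝ≥0∞) :=
          Finset.measurable_fun_sum _ fun j _ => (hme j).mul (hdx _)
        rw [lintegral_add_left hm, lintegral_finsetSum _ fun j _ => (hme j).mul_const _]
        simp only [lintegral_mul_const _ (hme _), hmarg]
    _ = _ := by
        congr 1
        conv_rhs => rw [← sum_restrict_preimage_singleton ν hq, lintegral_finsetSum_measure]
        refine Finset.sum_congr rfl fun j _ => ?_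
        rw [← smul_eq_mul, ← lintegral_smul_measure, hβν]
        refine setLIntegral_congr_fun (hq (measurableSet_singleton j)) fun z hz => ?_
        have hz : q z = j := hz
        rw [hz, nndist_comm]


/-! ### The upper bound for a given quantizer of the latent space -/

/-- A coupling of `P` with the law of `G` under `ν` lifts to a coupling of `P` with `ν`: the latent
variable is sampled from its conditional distribution given the value of `G`. -/
lemma exists_coupling_lift {𝒳 𝒵 : Type*} [PseudoMetricSpace 𝒳] [MeasurableSpace 𝒳]
    [MeasurableSpace 𝒵] [StandardBorelSpace 𝒵] [Nonempty 𝒵]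
    (hd : Measurable fun r : 𝒳 × 𝒳 => nndist r.1 r.2)
    (P : Measure 𝒳) [IsProbabilityMeasure P] (ν : Measure 𝒵) [IsProbabilityMeasure ν]
    {G : 𝒵 → 𝒳} (hG : Measurable G) (π : Measure (𝒳 × 𝒳)) (hfst : π.fst = P)
    (hsnd : π.snd = ν.map G) :
    ∃ ρ : Measure (𝒳 × 𝒵), ρ.fst = P ∧ ρ.snd = ν ∧
      ∫⁻ r, nndist r.1 (G r.2) ∂ρ ≤ ∫⁻ r, nndist r.1 r.2 ∂π := by
  have hπ : IsProbabilityMeasure π :=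
    ⟨by rw [← Measure.fst_univ, hfst, measure_univ]⟩
  let κ : Kernel 𝒳 𝒵 := condDistrib id G ν
  let σ : Measure ((𝒳 × 𝒳) × 𝒵) := π ⊗ₘ κ.comap Prod.snd measurable_snd
  have hσ : σ.map (fun r => (r.1.2, r.2)) = ν.map fun z => (G z, z) := by
    have h : ν.map G ⊗ₘ κ = ν.map fun z => (G z, z) :=
      compProd_map_condDistrib (μ := ν) (X := G) (Y := id) aemeasurable_id
    rw [← h, ← hsnd]
    have hm : Measurable fun r : (𝒳 × 𝒳) × 𝒵 => (r.1.2, r.2) := by fun_prop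
    ext s hs
    rw [Measure.map_apply hm hs, Measure.compProd_apply (hm hs), Measure.compProd_apply hs,
      Measure.snd, lintegral_map (Kernel.measurable_kernel_prodMk_left hs) measurable_snd]
    rfl
  have hm : Measurable fun r : (𝒳 × 𝒳) × 𝒵 => (r.1.1, r.2) := by fun_prop
  have hdG : Measurable fun r : 𝒳 × 𝒵 => (nndist r.1 (G r.2) : ℝ≥0∞) :=
    (hd.comp (measurable_fst.prodMk (hG.comp measurable_snd))).coe_nnreal_ennreal
  refine ⟨σ.map fun r => (r.1.1, r.2), ?_, ?_, ?_⟩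
  · rw [Measure.fst, Measure.map_map measurable_fst hm, ← hfst, Measure.fst,
      ← Measure.fst_compProd π (κ.comap Prod.snd measurable_snd), Measure.fst,
      Measure.map_map measurable_fst measurable_fst]
    rfl
  · have h : (σ.map fun r => (r.1.2, r.2)).map Prod.snd = ν := by
      rw [hσ, Measure.map_map measurable_snd (by fun_prop)]
      exact Measure.map_id
    rw [Measure.map_map measurable_snd (by fun_prop)] at h
    rw [Measure.snd, Measure.map_map measurable_snd hm]
    exact h
  · have hz : ∫⁻ r, nndist r.1.2 (G r.2) ∂σ = 0 := by
      have h := lintegral_map (μ := σ) hdG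
        (by fun_prop : Measurable fun r : (𝒳 × 𝒳) × 𝒵 => (r.1.2, r.2))
      rw [hσ, lintegral_map hdG (by fun_prop)] at h
      simpa using h.symm
    rw [lintegral_map hdG hm]
    have hd1 : Measurable fun r : (𝒳 × 𝒳) × 𝒵 => (nndist r.1.1 r.1.2 : ℝ≥0∞) :=
      (hd.comp measurable_fst).coe_nnreal_ennreal
    calc ∫⁻ r, nndist r.1.1 (G r.2) ∂σ
        ≤ ∫⁻ r, (nndist r.1.1 r.1.2 + nndist r.1.2 (G r.2) : ℝ≥0∞) ∂σ :=
          lintegral_mono fun r => coe_nndist_triangle _ _ _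
      _ = ∫⁻ r, nndist r.1.1 r.1.2 ∂σ := by rw [lintegral_add_left hd1, hz, add_zero]
      _ = ∫⁻ r, nndist r.1 r.2 ∂π := by
          rw [← Measure.fst_compProd π (κ.comap Prod.snd measurable_snd), Measure.fst,
            lintegral_map hd.coe_nnreal_ennreal measurable_fst]

/-- If the latent space has a quantizer with `card J` points, `2 * card J - 1` code words suffice to
reach the Wasserstein distance up to twice the quantization error, measured after applying `G`. -/
lemma minDistortion_le_add_quantization {𝒳 𝒵 J : Type*} [PseudoMetricSpace 𝒳] [MeasurableSpace 𝒳]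
    [MeasurableSpace 𝒵] [StandardBorelSpace 𝒵] [Nonempty 𝒵]
    [Fintype J] [Nonempty J] [MeasurableSpace J] [MeasurableSingletonClass J]
    (hd : Measurable fun r : 𝒳 × 𝒳 => nndist r.1 r.2)
    (P : Measure 𝒳) [IsProbabilityMeasure P] (ν : Measure 𝒵) [IsProbabilityMeasure ν]
    {G : 𝒵 → 𝒳} (hG : Measurable G) {q : 𝒵 → J} (hq : Measurable q) (pt : J → 𝒵) {R : ℝ}
    (hR : 2 * Fintype.card J ≤ ⌊(2 : ℝ) ^ R⌋₊ + 1)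
    (hfin : ∫⁻ z, nndist (G z) (G (pt (q z))) ∂ν ≠ ∞) :
    minDistortion nndist P ν G R ≤
      wasserstein nndist P (ν.map G) + 2 * ∫⁻ z, nndist (G z) (G (pt (q z))) ∂ν := by
  rw [wasserstein, ENNReal.iInf_add, le_iInf_iff]
  intro π
  rw [ENNReal.iInf_add, le_iInf_iff]
  rintro ⟨hfst, hsnd⟩
  by_cases hπ : ∫⁻ r, nndist r.1 r.2 ∂π = ∞
  · exact le_of_le_of_eq le_top (by rw [hπ, top_add])
  obtain ⟨ρ, hρfst, hρsnd, hρ⟩ := exists_coupling_lift hd P ν hG π hfst hsnd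
  have hρprob : IsProbabilityMeasure ρ := ⟨by rw [← Measure.fst_univ, hρfst, measure_univ]⟩
  have hρfin : ∫⁻ r, nndist r.1 (G r.2) ∂ρ ≠ ∞ := ne_top_of_le_ne_top hπ hρ
  have hdG : Measurable fun r : 𝒳 × 𝒵 => (nndist r.1 (G r.2) : ℝ≥0∞) :=
    (hd.comp (measurable_fst.prodMk (hG.comp measurable_snd))).coe_nnreal_ennreal
  have hdx : ∀ y, Measurable fun x => nndist x y := fun y =>
    hd.comp (measurable_id.prodMk measurable_const)
  have hpt : Measurable fun j => G (pt j) := measurable_of_countable _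
  have hdQ : Measurable fun z => (nndist (G z) (G (pt (q z))) : ℝ≥0∞) :=
    (hd.comp (hG.prodMk (hpt.comp hq))).coe_nnreal_ennreal
  have hQ : ∫⁻ r, nndist (G r.2) (G (pt (q r.2))) ∂ρ = ∫⁻ z, nndist (G z) (G (pt (q z))) ∂ν := by
    rw [← hρsnd, Measure.snd, lintegral_map hdQ measurable_snd]
  have hcost : ∫⁻ r, nndist r.1 (G (pt (q r.2))) ∂ρ ≤
      ∫⁻ r, nndist r.1 r.2 ∂π + ∫⁻ z, nndist (G z) (G (pt (q z))) ∂ν := by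
    rw [← hQ]
    calc ∫⁻ r, nndist r.1 (G (pt (q r.2))) ∂ρ
        ≤ ∫⁻ r, (nndist r.1 (G r.2) + nndist (G r.2) (G (pt (q r.2))) : ℝ≥0∞) ∂ρ :=
          lintegral_mono fun r => coe_nndist_triangle _ _ _
      _ = ∫⁻ r, nndist r.1 (G r.2) ∂ρ + ∫⁻ r, nndist (G r.2) (G (pt (q r.2))) ∂ρ :=
          lintegral_add_left hdG _
      _ ≤ _ := by gcongr
  let T : Measure (𝒳 × J) := ρ.map fun r => (r.1, q r.2)
  have hTm : Measurable fun r : 𝒳 × 𝒵 => (r.1, q r.2) := by fun_prop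
  have hTprob : IsProbabilityMeasure T := Measure.isProbabilityMeasure_map hTm.aemeasurable
  have hTfst : T.fst = P := by
    rw [Measure.fst, Measure.map_map measurable_fst hTm, ← hρfst]
    rfl
  have hTsnd : ∀ j, T.snd {j} = ν (q ⁻¹' {j}) := fun j => by
    rw [Measure.snd, Measure.map_map measurable_snd hTm, ← hρsnd, Measure.snd,
      Measure.map_apply measurable_snd (hq (measurableSet_singleton j)),
      Measure.map_apply (by fun_prop) (measurableSet_singleton j)]
    rfl
  have hcT : Measurable fun r : 𝒳 × J => (nndist r.1 (G (pt r.2)) : ℝ≥0∞) :=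
    (hd.comp (measurable_fst.prodMk (hpt.comp measurable_snd))).coe_nnreal_ennreal
  have hcfin : ∀ j, ∫⁻ x, nndist x (G (pt j)) ∂T.fst ≠ ∞ := by
    intro j
    obtain ⟨b, hb⟩ : ∃ b : ℝ≥0, ∀ k, nndist (G (pt k)) (G (pt j)) ≤ b :=
      ⟨_, fun k => Finset.le_sup (f := fun k => nndist (G (pt k)) (G (pt j))) (Finset.mem_univ k)⟩
    have hm : Measurable fun r : 𝒳 × 𝒵 => (nndist r.1 (G (pt (q r.2))) : ℝ≥0∞) := hcT.comp hTm
    rw [hTfst, ← hρfst, Measure.fst, lintegral_map (hdx _).coe_nnreal_ennreal measurable_fst]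
    refine ne_top_of_le_ne_top (b := ∫⁻ r, nndist r.1 (G (pt (q r.2))) ∂ρ + b) ?_ ?_
    · exact ENNReal.add_ne_top.2
        ⟨ne_top_of_le_ne_top (ENNReal.add_ne_top.2 ⟨hπ, hfin⟩) hcost, ENNReal.coe_ne_top⟩
    · calc ∫⁻ r, nndist r.1 (G (pt j)) ∂ρ
          ≤ ∫⁻ r, (nndist r.1 (G (pt (q r.2))) + b : ℝ≥0∞) ∂ρ :=
            lintegral_mono fun r => (coe_nndist_triangle _ (G (pt (q r.2))) _).trans
              (by gcongr; exact hb _)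
        _ = _ := by rw [lintegral_add_left hm, lintegral_const, measure_univ, mul_one]
  refine ENNReal.le_of_forall_pos_le_add fun ε hε _ => ?_
  obtain ⟨e, a, he, ha, hmarg, hle⟩ := exists_measurable_code T (fun x j => nndist x (G (pt j)))
    (fun j => hdx _) hcfin hR (ε := ε) (by simpa using hε.ne')
  rw [hTfst] at hle
  have hmarg : ∀ j, ∫⁻ x, a (e x) j ∂P = ν (q ⁻¹' {j}) := fun j => by
    rw [← hTsnd, ← hmarg, hTfst]
  calc minDistortion nndist P ν G R
      ≤ ∫⁻ x, ∑ j, (a (e x) j * nndist x (G (pt j)) : ℝ≥0∞) ∂P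
        + ∫⁻ z, nndist (G z) (G (pt (q z))) ∂ν :=
        minDistortion_le_of_code hd P ν hG hq pt he ha hmarg
    _ ≤ (∫⁻ r, nndist r.1 r.2 ∂π + ∫⁻ z, nndist (G z) (G (pt (q z))) ∂ν + ε)
        + ∫⁻ z, nndist (G z) (G (pt (q z))) ∂ν := by
        gcongr
        refine hle.trans ?_
        gcongr
        rw [lintegral_map hcT hTm]
        exact hcost
    _ = _ := by rw [two_mul]; abel

/-! ### The lower bound -/

/-- The joint law of the source and its reconstruction is a coupling. -/
lemma wasserstein_map_latentLaw_le_distortion {𝒳 𝒵 : Type*} [MeasurableSpace 𝒳]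
    [MeasurableSpace 𝒵] {d : 𝒳 → 𝒳 → ℝ≥0} (hd : Measurable fun r : 𝒳 × 𝒳 => d r.1 r.2)
    (P : Measure 𝒳) [IsProbabilityMeasure P] {G : 𝒵 → 𝒳} (hG : Measurable G) {R : ℝ}
    (E : Kernel 𝒳 (Code R)) [IsMarkovKernel E] (B : Kernel (Code R) 𝒵) [IsMarkovKernel B] :
    wasserstein d P ((latentLaw P E B).map G) ≤ distortion d P G E B := by
  have hm : Measurable fun r : 𝒳 × 𝒵 => (r.1, G r.2) := by fun_prop
  have hdG : Measurable fun r : 𝒳 × 𝒵 => (d r.1 (G r.2) : ℝ≥0∞) :=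
    (hd.comp hm).coe_nnreal_ennreal
  have hfst : ((P ⊗ₘ (B ∘ₖ E)).map fun r => (r.1, G r.2)).fst = P := by
    rw [Measure.fst, Measure.map_map measurable_fst hm]
    exact Measure.fst_compProd P (B ∘ₖ E)
  have hsnd : ((P ⊗ₘ (B ∘ₖ E)).map fun r => (r.1, G r.2)).snd = (latentLaw P E B).map G := by
    rw [Measure.snd, Measure.map_map measurable_snd hm, latentLaw, Measure.comp_assoc,
      ← Measure.snd_compProd P (B ∘ₖ E), Measure.snd, Measure.map_map hG measurable_snd]
    rfl
  refine (iInf₂_le _ ⟨hfst, hsnd⟩).trans_eq ?_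
  rw [lintegral_map hd.coe_nnreal_ennreal hm, Measure.lintegral_compProd hdG]
  refine lintegral_congr fun x => ?_
  exact Kernel.lintegral_comp B E x (hdG.comp measurable_prodMk_left)


/-! ### Quantizers of the latent space -/

/-- A quantitative form of the convexity of `x ↦ x ^ (-δ)`. -/
lemma mul_sub_le_rpow_mul_sub {δ a b : ℝ} (hδ : 0 < δ) (ha : 0 < a) (hb : 0 < b) :
    δ * (b - a) ≤ b ^ (1 + δ) * (a ^ (-δ) - b ^ (-δ)) := by
  have hab : 0 < a / b := div_pos ha hb
  have h1 : 1 + δ * (1 - a / b) ≤ (a / b) ^ (-δ) := by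
    rw [Real.rpow_def_of_pos hab]
    have h2 := Real.log_le_sub_one_of_pos hab
    have h3 := Real.add_one_le_exp (Real.log (a / b) * -δ)
    nlinarith
  have h2 : b ^ (1 + δ) * a ^ (-δ) = b * (a / b) ^ (-δ) := by
    rw [Real.div_rpow ha.le hb.le, Real.rpow_neg hb.le, Real.rpow_add hb, Real.rpow_one]
    have := Real.rpow_pos_of_pos hb δ
    field_simp
  have h3 : b ^ (1 + δ) * b ^ (-δ) = b := by
    rw [← Real.rpow_add hb]
    simp
  rw [mul_sub (b ^ (1 + δ)), h2, h3]
  have h4 := mul_le_mul_of_nonneg_left h1 hb.le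
  have h5 : b * (1 + δ * (1 - a / b)) = b + δ * (b - a) := by
    field_simp
  linarith

/-- A quantizer of the line with `2 * n - 1` levels. The companding function
`x ↦ 1 - (1 + |x|) ^ (-δ)` takes values in `[0, 1)` and is quantized uniformly, rounding towards
zero; the error at `x` is at most `1 / n` divided by the absolute derivative of this function. -/
lemma exists_line_quantizer {δ : ℝ} (hδ : 0 < δ) {n : ℕ} (hn : 0 < n) :
    ∃ (s : Finset ℝ) (r : ℝ → ℝ), s.card ≤ 2 * n - 1 ∧ Measurable r ∧ (∀ x, r x ∈ s) ∧
      ∀ x, |x - r x| ≤ (1 + |x|) ^ (1 + δ) / (δ * n) := by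
  classical
  have hn' : (0 : ℝ) < n := by exact_mod_cast hn
  let h : ℕ → ℝ := fun k => (1 - k / n) ^ (-δ⁻¹) - 1
  let k : ℝ → ℕ := fun x => ⌊n * (1 - (1 + |x|) ^ (-δ))⌋₊
  have h0 : h 0 = 0 := by simp [h]
  have hkm : Measurable k := by
    refine Nat.measurable_floor.comp ?_
    fun_prop
  have hkn : ∀ x, k x < n := fun x => by
    have := Real.rpow_pos_of_pos (by positivity : 0 < 1 + |x|) (-δ)
    rw [Nat.floor_lt' hn.ne']
    nlinarith
  refine ⟨(Finset.range n).image h ∪ (Finset.Ico 1 n).image fun k => -h k,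
    fun x => if 0 ≤ x then h (k x) else -h (k x), ?_, ?_, fun x => ?_, fun x => ?_⟩
  -- Both signs share the level `h 0 = 0`, so the negative levels start at index `1`.
  · refine (Finset.card_union_le _ _).trans ?_
    have h1 := Finset.card_image_le (s := Finset.range n) (f := h)
    have h2 := Finset.card_image_le (s := Finset.Ico 1 n) (f := fun k => -h k)
    rw [Finset.card_range] at h1
    rw [Nat.card_Ico] at h2
    omega
  · have hh : Measurable fun x => h (k x) := (measurable_of_countable h).comp hkm
    exact Measurable.ite measurableSet_Ici hh hh.neg
  · dsimp only
    split_ifs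
    · exact Finset.mem_union_left _ (Finset.mem_image_of_mem h (Finset.mem_range.2 (hkn x)))
    · rcases Nat.eq_zero_or_pos (k x) with hk | hk
      · rw [hk, h0, neg_zero]
        exact Finset.mem_union_left _ (Finset.mem_image.2 ⟨0, Finset.mem_range.2 hn, h0⟩)
      · exact Finset.mem_union_right _
          (Finset.mem_image_of_mem (fun k => -h k) (Finset.mem_Ico.2 ⟨hk, hkn x⟩))
  · have hb : 0 < 1 + |x| := by positivity
    have hu : 0 < (1 + |x|) ^ (-δ) := Real.rpow_pos_of_pos hb _
    have hu1 : (1 + |x|) ^ (-δ) ≤ 1 :=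
      Real.rpow_le_one_of_one_le_of_nonpos (by linarith [abs_nonneg x]) (by linarith)
    have hk1 : (k x : ℝ) ≤ n * (1 - (1 + |x|) ^ (-δ)) :=
      Nat.floor_le (mul_nonneg hn'.le (by linarith))
    have hk2 : n * (1 - (1 + |x|) ^ (-δ)) < k x + 1 := Nat.lt_floor_add_one _
    have hv1 : (1 + |x|) ^ (-δ) ≤ 1 - k x / n := by
      rw [le_sub_comm, div_le_iff₀ hn']
      linarith
    have hv2 : 1 - k x / n - (1 + |x|) ^ (-δ) ≤ 1 / n := by
      have h1 : (k x : ℝ) / n * n = k x := div_mul_cancel₀ _ hn'.ne'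
      rw [le_div_iff₀ hn']
      linarith
    have hv : 0 < 1 - (k x : ℝ) / n := hu.trans_le hv1
    have ha : 0 < 1 + h (k x) := by
      simpa [h] using Real.rpow_pos_of_pos hv _
    have hadelta : (1 + h (k x)) ^ (-δ) = 1 - k x / n := by
      simp only [h, add_sub_cancel]
      rw [← Real.rpow_mul hv.le]
      simp [hδ.ne']
    have hab : h (k x) ≤ |x| := by
      have := Real.rpow_le_rpow_of_nonpos hu hv1 (by simpa using hδ.le : -δ⁻¹ ≤ 0)
      rw [← Real.rpow_mul hb.le, neg_mul_neg, mul_inv_cancel₀ hδ.ne', Real.rpow_one] at this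
      simp only [h]
      linarith
    have herr : |x| - h (k x) ≤ (1 + |x|) ^ (1 + δ) / (δ * n) := by
      have h1 := mul_sub_le_rpow_mul_sub hδ ha hb
      rw [hadelta] at h1
      have h2 := mul_le_mul_of_nonneg_left hv2 (Real.rpow_pos_of_pos hb (1 + δ)).le
      have h3 : δ * (|x| - h (k x)) ≤ (1 + |x|) ^ (1 + δ) * (1 / n) := by linarith
      rw [le_div_iff₀ (by positivity)]
      rw [mul_one_div, le_div_iff₀ hn'] at h3
      linarith
    refine le_of_eq_of_le ?_ herr
    dsimp only
    split_ifs with hx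
    · rw [abs_of_nonneg hx] at hab ⊢
      exact abs_of_nonneg (by linarith)
    · rw [abs_of_neg (not_le.1 hx)] at hab ⊢
      rw [abs_of_nonpos (by linarith)]
      ring

lemma exists_abs_apply_le_mul_seminorm {m : ℕ} (N : Seminorm ℝ (Fin m → ℝ))
    (hN : ∀ z, N z = 0 → z = 0) : ∃ a : ℝ, 0 ≤ a ∧ ∀ z i, |z i| ≤ a * N z := by
  rcases isEmpty_or_nonempty (Fin m) with h | h
  · exact ⟨0, le_rfl, fun z i => h.elim i⟩
  have hcont : Continuous N := N.convexOn.locallyLipschitz.continuous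
  obtain ⟨z₀, hz₀, hmin⟩ := (isCompact_sphere (0 : Fin m → ℝ) 1).exists_isMinOn
    (NormedSpace.sphere_nonempty.2 zero_le_one) hcont.continuousOn
  have hpos : 0 < N z₀ := (apply_nonneg N z₀).lt_of_ne fun h0 => by
    rw [hN z₀ h0.symm] at hz₀
    simp at hz₀
  refine ⟨(N z₀)⁻¹, by positivity, fun z i => (norm_le_pi_norm z i).trans ?_⟩
  rcases eq_or_ne z 0 with rfl | hz
  · simp
  have hz' : 0 < ‖z‖ := norm_pos_iff.2 hz
  have h1 : N z₀ ≤ N (‖z‖⁻¹ • z) := hmin (by simp [norm_smul, hz'.ne'])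
  rw [map_smul_eq_mul, norm_inv, norm_norm, inv_mul_eq_div, le_div_iff₀ hz'] at h1
  rw [inv_mul_eq_div, le_div_iff₀ hpos]
  linarith

lemma seminorm_le_sum_abs_mul {m : ℕ} (N : Seminorm ℝ (Fin m → ℝ)) (z : Fin m → ℝ) :
    N z ≤ ∑ i, |z i| * N (Pi.single i 1) := by
  calc N z = N (∑ i, z i • Pi.single i 1) := by rw [← pi_eq_sum_univ' z]
    _ ≤ ∑ i, N (z i • Pi.single i 1) := 
      Finset.le_sum_of_subadditive N (map_zero N).le (map_add_le_add N) _ _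
    _ = ∑ i, |z i| * N (Pi.single i 1) := by simp only [map_smul_eq_mul, Real.norm_eq_abs]

lemma one_add_rpow_le {x p : ℝ} (hx : 0 ≤ x) (hp : 0 ≤ p) :
    (1 + x) ^ p ≤ 2 ^ p * (1 + x ^ p) := by
  have hxp := Real.rpow_nonneg hx p
  have h2 : (0 : ℝ) < 2 ^ p := by positivity
  rcases le_total x 1 with h | h
  · have := Real.rpow_le_rpow (by linarith) (by linarith : 1 + x ≤ 2) hp
    nlinarith
  · have := Real.rpow_le_rpow (by linarith) (by linarith : 1 + x ≤ 2 * x) hp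
    rw [Real.mul_rpow zero_le_two hx] at this
    nlinarith

/-- Product quantizers: with `2 * n - 1` levels in each coordinate, the error is of order `1 / n`
times a pointwise quantity whose mean is controlled by the moment of order `1 + δ`. -/
lemma exists_product_quantizer {m : ℕ} (N : Seminorm ℝ (Fin m → ℝ)) (hN : ∀ z, N z = 0 → z = 0)
    {δ : ℝ} (hδ : 0 < δ) :
    ∃ A : ℝ, 0 ≤ A ∧ ∀ n : ℕ, 0 < n → ∃ (s : Finset ℝ) (q : (Fin m → ℝ) → Fin m → s),
      s.card ≤ 2 * n - 1 ∧ s.Nonempty ∧ Measurable q ∧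
      ∀ z, N (z - fun i => (q z i : ℝ)) ≤ A / n * (1 + N z ^ (1 + δ)) := by
  obtain ⟨a, ha, hNa⟩ := exists_abs_apply_le_mul_seminorm N hN
  set b : ℝ := ∑ i, N (Pi.single i 1) with hb
  have hb0 : 0 ≤ b := Finset.sum_nonneg fun i _ => apply_nonneg N _
  refine ⟨b * 2 ^ (1 + δ) * (1 + a ^ (1 + δ)) / δ, by positivity, fun n hn => ?_⟩
  have hn' : (0 : ℝ) < n := by exact_mod_cast hn
  obtain ⟨s, r, hcard, hr, hrs, herr⟩ := exists_line_quantizer hδ hn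
  refine ⟨s, fun z i => ⟨r (z i), hrs _⟩, hcard, ⟨r 0, hrs 0⟩,
    measurable_pi_iff.2 fun i => (hr.comp (measurable_pi_apply i)).subtype_mk, fun z => ?_⟩
  have hNz := apply_nonneg N z
  have hNzp := Real.rpow_nonneg hNz (1 + δ)
  have hap := Real.rpow_nonneg ha (1 + δ)
  have key : ∀ i, |z i - r (z i)| ≤
      2 ^ (1 + δ) * (1 + a ^ (1 + δ)) * (1 + N z ^ (1 + δ)) / (δ * n) := by
    intro i
    refine (herr (z i)).trans ?_
    gcongr
    calc (1 + |z i|) ^ (1 + δ) ≤ (1 + a * N z) ^ (1 + δ) := by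
          gcongr
          exact hNa z i
      _ ≤ 2 ^ (1 + δ) * (1 + (a * N z) ^ (1 + δ)) := one_add_rpow_le (by positivity) (by positivity)
      _ ≤ 2 ^ (1 + δ) * ((1 + a ^ (1 + δ)) * (1 + N z ^ (1 + δ))) := by
          rw [Real.mul_rpow ha hNz]
          gcongr
          nlinarith
      _ = _ := by ring
  calc N (z - fun i => r (z i))
      ≤ ∑ i, |z i - r (z i)| * N (Pi.single i 1) := seminorm_le_sum_abs_mul N _
    _ ≤ ∑ i, 2 ^ (1 + δ) * (1 + a ^ (1 + δ)) * (1 + N z ^ (1 + δ)) / (δ * n) *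
          N (Pi.single i 1) := by
        gcongr with i
        exact key i
    _ = _ := by
        rw [← Finset.mul_sum, ← hb]
        field_simp

/-- The number of levels per coordinate at rate `R`: of order `2 ^ (R / m)`, and small enough for
the product quantizer to be usable with `⌊2 ^ R⌋` code words. -/
lemma exists_levels {m : ℕ} (hm : 0 < m) {R : ℝ} (hR : 0 ≤ R) :
    ∃ n : ℕ, 0 < n ∧ 2 * (2 * n - 1) ^ m ≤ ⌊(2 : ℝ) ^ R⌋₊ + 1 ∧
      (1 : ℝ) / n ≤ 8 * 2 ^ (-(R / m)) := by
  have hm' : (0 : ℝ) < m := by exact_mod_cast hm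
  set t : ℝ := 2 ^ (R / m) with ht
  have ht0 : 0 < t := by positivity
  have htm : t ^ m = 2 ^ R := by
    rw [ht, ← Real.rpow_natCast, ← Real.rpow_mul zero_le_two, div_mul_cancel₀ _ hm'.ne']
  have hR1 : (1 : ℝ) ≤ 2 ^ R := Real.one_le_rpow one_le_two hR
  -- Either `n = 1`, or `n - 1 < t / 8` and `2 * n - 1 ≤ 3 * (n - 1)`, so that `2 * n - 1 ≤ t / 2`.
  refine ⟨⌈t / 8⌉₊, Nat.ceil_pos.2 (by positivity), ?_, ?_⟩
  · rcases Nat.lt_or_ge ⌈t / 8⌉₊ 2 with hn | hn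
    · have : ⌈t / 8⌉₊ = 1 := by
        have := Nat.ceil_pos.2 (by positivity : 0 < t / 8)
        omega
      have := Nat.one_le_floor_iff _ |>.2 hR1
      simp_all
    · refine (Nat.le_floor ?_).trans (Nat.le_succ _)
      have h1 := Nat.ceil_lt_add_one (by positivity : 0 ≤ t / 8)
      have h2 : (2 : ℝ) ≤ ⌈t / 8⌉₊ := by exact_mod_cast hn
      have h3 : ((2 * ⌈t / 8⌉₊ - 1 : ℕ) : ℝ) ≤ t / 2 := by
        rw [Nat.cast_sub (by omega)]
        push_cast
        linarith
      push_cast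
      calc 2 * ((2 * ⌈t / 8⌉₊ - 1 : ℕ) : ℝ) ^ m ≤ 2 * (t / 2) ^ m := by gcongr
        _ = 2 * (1 / 2) ^ m * t ^ m := by rw [div_pow, div_pow]; ring
        _ ≤ 1 * t ^ m := by
            gcongr
            have := pow_le_of_le_one (by norm_num : (0 : ℝ) ≤ 1 / 2) (by norm_num) hm.ne'
            linarith
        _ = 2 ^ R := by rw [one_mul, htm]
  · rw [Real.rpow_neg zero_le_two, ← ht]
    have h1 := Nat.le_ceil (t / 8)
    have h2 : (0 : ℝ) < ⌈t / 8⌉₊ := by linarith [div_pos ht0 (by norm_num : (0 : ℝ) < 8)]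
    rw [div_le_iff₀ h2, ← div_eq_mul_inv, div_mul_eq_mul_div, le_div_iff₀ ht0]
    linarith

end DPLC

/-! ### The rate-distortion bounds -/

theorem theorem1 {m : ℕ} (hm : 0 < m)
    -- a norm on `ℝ^m`
    (N : Seminorm ℝ (Fin m → ℝ)) (hN : ∀ z, N z = 0 → z = 0)
    (δ : ℝ) (hδ : 0 < δ) (M : ℝ≥0) :
    -- the constant depends on `m`, the norm, `δ` and the moment `M` only
    (∃ C : ℝ, 0 < C ∧
      ∀ (PZ : Measure (Fin m → ℝ)) [IsProbabilityMeasure PZ],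
      ∫⁻ z, ENNReal.ofReal (N z ^ (1 + δ)) ∂PZ = M →
      ∀ (𝒳 : Type u) [MetricSpace 𝒳] [MeasurableSpace 𝒳],
      Measurable (fun q : 𝒳 × 𝒳 => nndist q.1 q.2) →
      ∀ (PX : Measure 𝒳) [IsProbabilityMeasure PX]
        (G : (Fin m → ℝ) → 𝒳) (K : ℝ≥0), Measurable G →
      (∀ x y, dist (G x) (G y) ≤ K * N (x - y)) →
      ∀ R : ℝ, 0 ≤ R →
        DPLC.wasserstein nndist PX (PZ.map G)
            ≤ DPLC.minDistortionRandomized nndist PX PZ G R ∧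
        DPLC.minDistortionRandomized nndist PX PZ G R
            ≤ DPLC.minDistortion nndist PX PZ G R ∧
        DPLC.minDistortion nndist PX PZ G R
            ≤ DPLC.wasserstein nndist PX (PZ.map G)
              + ENNReal.ofReal ((2 : ℝ) ^ (-(R / m)) * K * C)) ∧
    -- arbitrary distortion measure, arbitrary generator, no moment assumption
    (∀ (PZ : Measure (Fin m → ℝ)) [IsProbabilityMeasure PZ]
      (𝒳 : Type u) [MeasurableSpace 𝒳] (PX : Measure 𝒳) [IsProbabilityMeasure PX]
      (d : 𝒳 → 𝒳 → ℝ≥0), Measurable (fun q : 𝒳 × 𝒳 => d q.1 q.2) →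
      ∀ G : (Fin m → ℝ) → 𝒳, Measurable G →
      ∀ R : ℝ, 0 ≤ R →
      ∀ (E : Kernel 𝒳 (DPLC.Code R)) [IsMarkovKernel E]
        (B : Kernel (DPLC.Code R) (Fin m → ℝ)) [IsMarkovKernel B],
      DPLC.latentLaw PX E B = PZ →
        DPLC.wasserstein d PX ((DPLC.latentLaw PX E B).map G)
          = DPLC.wasserstein d PX (PZ.map G)) := by
  obtain ⟨A, hA, hquant⟩ := DPLC.exists_product_quantizer N hN hδ
  constructor
  · refine ⟨16 * A * (1 + M) + 1, by positivity, ?_⟩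
    intro PZ _ hM 𝒳 _ _ hd PX _ G K hG hLip R hR
    refine ⟨?_, ?_, ?_⟩
    · refine le_iInf₂ fun E hE => le_iInf₂ fun B hB => le_iInf fun hlaw => ?_
      rw [← hlaw]
      exact DPLC.wasserstein_map_latentLaw_le_distortion hd PX hG E B
    · refine le_iInf₂ fun E hE => le_iInf₂ fun B hB => le_iInf fun hlaw => ?_
      exact iInf₂_le_of_le (Kernel.deterministic E hE) inferInstance
        (iInf₂_le_of_le B hB (iInf_le _ hlaw))
    -- The quantization error enters twice, and `1 / n ≤ 8 * 2 ^ (-(R / m))`: hence the factor `16`.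
    -- The summand `1` only makes the constant positive.
    · obtain ⟨n, hn, hcode, hrate⟩ := DPLC.exists_levels hm hR
      obtain ⟨s, q, hcard, ⟨x₀, hx₀⟩, hq, herr⟩ := hquant n hn
      have : Nonempty s := ⟨⟨x₀, hx₀⟩⟩
      have hcard' : 2 * Fintype.card (Fin m → s) ≤ ⌊(2 : ℝ) ^ R⌋₊ + 1 := by
        rw [Fintype.card_fun, Fintype.card_fin, Fintype.card_coe]
        exact (Nat.mul_le_mul_left 2 (Nat.pow_le_pow_left hcard m)).trans hcode
      have herror : ∫⁻ z, nndist (G z) (G fun i => (q z i : ℝ)) ∂PZ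
          ≤ ENNReal.ofReal (K * (A / n) * (1 + M)) := by
        calc ∫⁻ z, nndist (G z) (G fun i => (q z i : ℝ)) ∂PZ
            ≤ ∫⁻ z, ENNReal.ofReal (K * (A / n)) * (1 + ENNReal.ofReal (N z ^ (1 + δ))) ∂PZ := by
              refine lintegral_mono fun z => ?_
              have hp : 0 ≤ N z ^ (1 + δ) := Real.rpow_nonneg (apply_nonneg N z) _
              rw [← ENNReal.ofReal_one, ← ENNReal.ofReal_add zero_le_one hp,
                ← ENNReal.ofReal_mul (by positivity), ← ENNReal.ofReal_coe_nnreal, coe_nndist]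
              refine ENNReal.ofReal_le_ofReal ((hLip _ _).trans ?_)
              rw [mul_assoc]
              exact mul_le_mul_of_nonneg_left (herr z) K.coe_nonneg
          _ = ENNReal.ofReal (K * (A / n)) * (1 + M) := by
              rw [lintegral_const_mul' _ _ ENNReal.ofReal_ne_top,
                lintegral_add_left measurable_const, lintegral_const, measure_univ, mul_one, hM]
          _ = ENNReal.ofReal (K * (A / n) * (1 + M)) := by
              rw [ENNReal.ofReal_mul (p := K * (A / n)) (by positivity),
                ENNReal.ofReal_add zero_le_one M.coe_nonneg,
                ENNReal.ofReal_one, ENNReal.ofReal_coe_nnreal]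
      refine (DPLC.minDistortion_le_add_quantization hd PX PZ hG hq (fun j i => (j i : ℝ)) hcard'
        (ne_top_of_le_ne_top ENNReal.ofReal_ne_top herror)).trans ?_
      gcongr
      refine (mul_le_mul_right herror 2).trans ?_
      rw [← ENNReal.ofReal_ofNat 2, ← ENNReal.ofReal_mul zero_le_two]
      refine ENNReal.ofReal_le_ofReal ?_
      calc 2 * (K * (A / n) * (1 + M)) = 2 * K * A * (1 + M) * (1 / n) := by ring
        _ ≤ 2 * K * A * (1 + M) * (8 * 2 ^ (-(R / m))) := by gcongr
        _ = 2 ^ (-(R / m)) * K * (16 * A * (1 + M)) := by ring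
        _ ≤ 2 ^ (-(R / m)) * K * (16 * A * (1 + M) + 1) := by
            gcongr
            linarith
  · intro PZ _ 𝒳 _ PX _ d _ G _ R _ E _ B _ hlaw
    rw [hlaw]
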